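/- Let $M$ be a smooth, connected, compact (Hausdorff) manifold, possibly with boundary, such that $H_1(M;\mathbb Z)$ is free with basis $\Gamma_1,\dots,\Gamma_b$, and let $\eta_1,\dots,\eta_b$ be smooth closed one-forms on $M$ dual to this basis: $\int_{\Gamma_j}\eta_i=\delta_{ij}$. Let $\pi:\tilde M_a\to M$ be the universal Abelian cover, i.e. the connected covering space with $\pi_*\pi_1(\tilde M_a,\tilde p)=[\pi_1(M,\pi(\tilde p)),\pi_1(M,\pi(\tilde p))]$ for all $\tilde p$. Fix $\tilde p_0\in\tilde M_a$ and let $\tilde\iota:\tilde M_a\to\mathbb R^b$ be the Abel--Jacobi map, $\tilde\iota_i(\tilde p)=\int_\gamma\pi^*\eta_i$ for any smooth path $\gamma$ in $\tilde M_a$ from $\tilde p_0$ to $\tilde p$. Let $f:M\to M$ be continuous, let $A\in M_b(\mathbb Z)$ be the matrix of $f_*:H_1(M;\mathbb Z)\to H_1(M;\mathbb Z)$ in the basis $\Gamma_j$, and assume that no complex eigenvalue of $A$ is a root of unity. Let $\Phi_A:\mathbb T^b\to\mathbb T^b$, $\mathbb T^b=\mathbb R^b/\mathbb Z^b$, be the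 toral endomorphism induced by $A$. Let $\tilde f:\tilde M_a\to\tilde M_a$ be a lift of $f$. For $k\ge 1$ put $BF_k(A)=\mathbb Z^b/(A^k-I)\mathbb Z^b$. If $f^k(x)=x$ and $\tilde x$ is a lift of $x$, then $n=\tilde\iota\tilde f^k(\tilde x)-\tilde\iota(\tilde x)$ is in $\mathbb Z^b$; the displacement of $x$ is $D_k(x,f^k)=n+(A^k-I)\mathbb Z^b\in BF_k(A)$, and $\alpha(x)=(A^k-I)^{-1}n+\mathbb Z^b\in\mathbb T^b$; neither depends on the choice of $\tilde x$. If $\Phi_A^k(y)=y$ and $\tilde y\in\mathbb R^b$ is a lift of $y$, its displacement is $D_k(y,\Phi_A^k)=A^k\tilde y-\tilde y+(A^k-I)\mathbb Z^b\in BF_k(A)$. Say that $x\in M$ and $y\in\mathbb T^b$ globally shadow if there are lifts $\tilde x$ of $x$, $\tilde y$ of $y$ and $\tilde f$ of $f$, and a constant $K$, such that $\|\tilde\iota\tilde f^m(\tilde x)-A^m\tilde y\|\le K$ for all $m\in\mathbb N$. Let $k\ge1$, $f^k(x)=x$ and $\Phi_A^k(y)=y$. Then $D_k(x,f^k)=D_k(y,\Phi_A^k)$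 if and only if $\alpha(x)=y$, and in this case $x$ and $y$ globally shadow. (No expansion hypothesis on $A$ is needed.) -/

import Mathlib

open Set Topology CategoryTheory Manifold
open scoped ContDiff

universe u

namespace GlobalShadow

noncomputable section

/-! ### First homology -/

/-- The coefficient module `ℤ`, moved to the universe of the space. -/
abbrev coeffs : ModuleCat.{u} ℤ := ModuleCat.of ℤ (ULift.{u} ℤ)

/-- The singular chain complex of `X` with integer coefficients. -/
abbrev singularChains (X : Type u) [TopologicalSpace X] : ChainComplex (ModuleCat.{u} ℤ) ℕ :=
  ((AlgebraicTopology.singularChainComplexFunctor (ModuleCat.{u} ℤ)).obj coeffs).obj (TopCat.of X)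

/-- The first singular homology group `H₁(X; ℤ)`. -/
abbrev H1 (X : Type u) [TopologicalSpace X] : ModuleCat.{u} ℤ :=
  ((AlgebraicTopology.singularHomologyFunctor (ModuleCat.{u} ℤ) 1).obj coeffs).obj (TopCat.of X)

/-- The map `f_* : H₁(X; ℤ) → H₁(X; ℤ)` induced by a continuous map `f`. -/
def H1map {X : Type u} [TopologicalSpace X] (f : C(X, X)) : H1 X →ₗ[ℤ] H1 X :=
  (((AlgebraicTopology.singularHomologyFunctor (ModuleCat.{u} ℤ) 1).obj coeffs).map
    (TopCat.ofHom f)).hom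

/-- A path, viewed as a singular `1`-simplex. -/
def pathSimplex {X : Type u} [TopologicalSpace X] {x y : X} (γ : Path x y) :
    (TopCat.toSSet.obj (TopCat.of X)).obj (.op (SimplexCategory.mk 1)) :=
  (TopCat.toSSetObjEquiv (TopCat.of X) (.op (SimplexCategory.mk 1))).symm
    (γ.toContinuousMap.comp
      ⟨stdSimplexHomeomorphUnitInterval, stdSimplexHomeomorphUnitInterval.continuous⟩)

/-- A path, viewed as a singular `1`-chain. -/
def pathChain {X : Type u} [TopologicalSpace X] {x y : X} (γ : Path x y) :
    (singularChains X).X 1 :=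
  (SSet.ιChainComplex (R := coeffs.{u}) (TopCat.toSSet.obj (TopCat.of X)) (pathSimplex γ)).hom
    (ULift.up (1 : ℤ))

/-- The loop `γ` represents the homology class `a`: the singular `1`-chain `γ` is a cycle whose
homology class is `a`. -/
def Represents {X : Type u} [TopologicalSpace X] {x : X} (γ : Path x x) (a : H1 X) : Prop :=
  ∃ z : (singularChains X).cycles 1,
    ((singularChains X).iCycles 1).hom z = pathChain γ ∧
      ((singularChains X).homologyπ 1).hom z = a

/-! ### The universal Abelian cover -/

/-- `π : Ma → M` is a universal Abelian cover of `M`: a connected covering space whose fundamental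
group is the commutator subgroup of that of `M`; equivalently, it is the quotient of the universal
cover by the commutator subgroup. -/
structure IsUniversalAbelianCover {M Ma : Type*} [TopologicalSpace M] [TopologicalSpace Ma]
    (π : C(Ma, M)) : Prop where
  isCoveringMap : IsCoveringMap π
  surjective : Function.Surjective π
  pathConnected : PathConnectedSpace Ma
  range_eq : ∀ p : Ma, (FundamentalGroup.map π p).range = commutator (FundamentalGroup M (π p))

/-- `F` is a lift of `f` through `π`. -/
def IsLift {M Ma : Type*} [TopologicalSpace M] [TopologicalSpace Ma]
    (π : C(Ma, M)) (f : C(M, M)) (F : Ma → Ma) : Prop :=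
  Continuous F ∧ ∀ p, π (F p) = f (π p)

/-! ### Closed one-forms, their integrals, and the Abel-Jacobi map -/

section Forms

variable {E : Type*} [NormedAddCommGroup E] [NormedSpace ℝ E] {H : Type*} [TopologicalSpace H]
  (I : ModelWithCorners ℝ E H) {M : Type*} [TopologicalSpace M] [ChartedSpace H M]

/-- The expression of the one-form `η` in the preferred chart around `x`. -/
def chartForm (η : ∀ x : M, TangentSpace I x →L[ℝ] ℝ) (x : M) (z : E) : E →L[ℝ] ℝ :=
  (η ((extChartAt I x).symm z)).comp
    (mfderivWithin 𝓘(ℝ, E) I (extChartAt I x).symm (range I) z)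

/-- `η` is a smooth closed one-form: in charts its coefficients are smooth and `dη = 0`. -/
def IsClosedOneForm (η : ∀ x : M, TangentSpace I x →L[ℝ] ℝ) : Prop :=
  ∀ x : M, ContDiffOn ℝ ∞ (chartForm I η x) (extChartAt I x).target ∧
    ∀ z ∈ (extChartAt I x).target, ∀ v w : E,
      fderivWithin ℝ (chartForm I η x) (extChartAt I x).target z v w =
        fderivWithin ℝ (chartForm I η x) (extChartAt I x).target z w v

/-- The path `γ` in the manifold is smooth on `[0, 1]`. -/
def IsSmoothPath {x y : M} (γ : Path x y) : Prop :=
  ContMDiffOn 𝓘(ℝ, ℝ) I ∞ γ.extend (Icc 0 1)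

/-- The integral `∫_γ η = ∫₀¹ η(γ'(t)) dt`. -/
def pathIntegral (η : ∀ x : M, TangentSpace I x →L[ℝ] ℝ) {x y : M} (γ : Path x y) : ℝ :=
  ∫ t in (0 : ℝ)..1, η (γ.extend t) (mfderivWithin 𝓘(ℝ, ℝ) I γ.extend (Icc 0 1) t (1 : ℝ))

/-- `η(a) = r`: the integral of the closed one-form `η` over the homology class `a`, computed on a
smooth loop that represents `a`, is `r`. -/
def HasPeriod {M : Type u} [TopologicalSpace M] [ChartedSpace H M]
    (η : ∀ x : M, TangentSpace I x →L[ℝ] ℝ) (a : H1 M) (r : ℝ) : Prop :=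
  ∃ (x : M) (γ : Path x x), IsSmoothPath I γ ∧ Represents γ a ∧ pathIntegral I η γ = r

/-- The Abel-Jacobi map `Ma → ℝᵇ` with base point `p₀`: its `i`-th coordinate at `p` is the common
value of the integrals of (the lift of) `η i` along the smooth paths in the cover from `p₀`
to `p`. -/
def abelJacobi {Ma : Type*} [TopologicalSpace Ma] (π : C(Ma, M)) {b : ℕ}
    (η : Fin b → ∀ x : M, TangentSpace I x →L[ℝ] ℝ) (p₀ p : Ma) : Fin b → ℝ :=
  fun i => Classical.epsilon fun r : ℝ =>
    ∃ γ : Path p₀ p, IsSmoothPath I (γ.map π.continuous) ∧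
      pathIntegral I (η i) (γ.map π.continuous) = r

end Forms

/-! ### Toral endomorphisms -/

section Torus

variable {b : ℕ}

/-- The torus `𝕋ᵇ = ℝᵇ/ℤᵇ`. -/
abbrev Torus (b : ℕ) : Type := Fin b → AddCircle (1 : ℝ)

/-- The covering projection `ℝᵇ → 𝕋ᵇ`. -/
def torusProj (v : Fin b → ℝ) : Torus b := fun i => (v i : AddCircle (1 : ℝ))

theorem torusProj_surjective : Function.Surjective (torusProj (b := b)) := fun y =>
  ⟨fun i => (QuotientAddGroup.mk_surjective (y i)).choose,
    funext fun i => (QuotientAddGroup.mk_surjective (y i)).choose_spec⟩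

/-- The linear action of an integer matrix on `ℝᵇ`. -/
def linAct (A : Matrix (Fin b) (Fin b) ℤ) (v : Fin b → ℝ) : Fin b → ℝ :=
  (A.map (Int.cast : ℤ → ℝ)).mulVec v

/-- The toral endomorphism `Φ_A : 𝕋ᵇ → 𝕋ᵇ`. -/
def toralEnd (A : Matrix (Fin b) (Fin b) ℤ) (y : Torus b) : Torus b :=
  fun i => ∑ j, A i j • y j

theorem toralEnd_torusProj (A : Matrix (Fin b) (Fin b) ℤ) (v : Fin b → ℝ) :
    toralEnd A (torusProj v) = torusProj (linAct A v) := by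
  funext i
  have h : ∀ (s : Finset (Fin b)) (g : Fin b → ℝ),
      (((∑ j ∈ s, g j : ℝ)) : AddCircle (1 : ℝ)) = ∑ j ∈ s, ((g j : ℝ) : AddCircle (1 : ℝ)) :=
    fun s g => map_sum (QuotientAddGroup.mk' (AddSubgroup.zmultiples (1 : ℝ))) g s
  simp only [toralEnd, torusProj, linAct, Matrix.mulVec, dotProduct, Matrix.map_apply]
  rw [h]
  refine Finset.sum_congr rfl fun j _ => ?_
  rw [← zsmul_eq_mul]
  rfl

/-- No complex eigenvalue of `A` is a root of unity. -/
def NoRootOfUnityEigenvalue (A : Matrix (Fin b) (Fin b) ℤ) : Prop :=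
  ∀ (μ : ℂ) (m : ℕ), 0 < m → μ ^ m = 1 →
    ¬ Module.End.HasEigenvalue (Matrix.toLin' (A.map (Int.cast : ℤ → ℂ))) μ

end Torus

/-! ### Displacements in the Bowen-Franks group, the comparison map, and shadowing -/

section Displacement

variable {b : ℕ}

/-- The Bowen-Franks group `BF_k(A) = ℤᵇ/(Aᵏ - I)ℤᵇ`. -/
abbrev BowenFranks (A : Matrix (Fin b) (Fin b) ℤ) (k : ℕ) : Type :=
  (Fin b → ℤ) ⧸ LinearMap.range (Matrix.mulVecLin (A ^ k - 1))

variable {X Xa : Type*}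

/-- The translation of `p` under `F`, measured by `ι`. -/
def translation (ι : Xa → Fin b → ℝ) (F : Xa → Xa) (p : Xa) : Fin b → ℝ := ι (F p) - ι p

/-- The displacement `D_k(x, F) ∈ BF_k(A)` of `x ∈ X`, where `F` is a lift to `Xa` of a map that
fixes `x`: the class of the translation of a lift of `x` under `F`. This translation is a vector of
integers, so that taking floors just reads it as an element of `ℤᵇ`. -/
def displacement (A : Matrix (Fin b) (Fin b) ℤ) (k : ℕ) {π : Xa → X} (hπ : Function.Surjective π)
    (ι : Xa → Fin b → ℝ) (F : Xa → Xa) (x : X) : BowenFranks A k :=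
  Submodule.Quotient.mk fun i => ⌊translation ι F (Function.surjInv hπ x) i⌋

/-- The comparison map on lifts: the solution `v ∈ ℝᵇ` of `Aᵏ v = v + n`, where `n` is the
translation of `p` under `F`. -/
def alphaLift (A : Matrix (Fin b) (Fin b) ℤ) (k : ℕ) (ι : Xa → Fin b → ℝ) (F : Xa → Xa) (p : Xa) :
    Fin b → ℝ :=
  ((A.map (Int.cast : ℤ → ℝ)) ^ k - 1)⁻¹.mulVec (translation ι F p)

/-- The comparison map `α` from points `x` of period `k` to points of `𝕋ᵇ` of period `k`. -/
def alpha (A : Matrix (Fin b) (Fin b) ℤ) (k : ℕ) {π : Xa → X} (hπ : Function.Surjective π)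
    (ι : Xa → Fin b → ℝ) (F : Xa → Xa) (x : X) : Torus b :=
  torusProj (alphaLift A k ι F (Function.surjInv hπ x))

/-- The orbits of `p` under `F` and of `v` under `A` shadow: their Euclidean distance in `ℝᵇ` is
bounded. -/
def Shadow (A : Matrix (Fin b) (Fin b) ℤ) (ι : Xa → Fin b → ℝ) (F : Xa → Xa) (p : Xa)
    (v : Fin b → ℝ) : Prop :=
  ∃ K : ℝ, ∀ n : ℕ, dist (WithLp.toLp 2 (ι (F^[n] p))) (WithLp.toLp 2 ((linAct A)^[n] v)) ≤ K

/-- The orbits `(x, f)` and `(y, Φ_A)` globally shadow: some lifts of `x`, `y` and `f` shadow. -/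
def GloballyShadow [TopologicalSpace X] [TopologicalSpace Xa] (A : Matrix (Fin b) (Fin b) ℤ)
    (π : C(Xa, X)) (ι : Xa → Fin b → ℝ) (f : C(X, X)) (x : X) (y : Torus b) : Prop :=
  ∃ (F : Xa → Xa) (p : Xa) (v : Fin b → ℝ),
    IsLift π f F ∧ π p = x ∧ torusProj v = y ∧ Shadow A ι F p v

end Displacement

end

end GlobalShadow

namespace GlobalShadow

/-! Write B for A^k - I. No eigenvalue of A is a root of unity, so B is invertible over the reals.
If n is the translation of a lift of x and m = A^k w - w for a lift w of y, then w = B⁻¹m. Hence n -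
m lies in Bℤ^b exactly when B⁻¹n - w lies in ℤ^b, which is the equivalence
(`mk_eq_mk_iff_torusProj_eq`).

For shadowing, start the linear orbit at v = B⁻¹n and let e_j be the difference of the two orbits at
time j. The choice of v gives e_k = e_0. Since F^(j+k) p and F^j p lie in one fibre, e_(j+k) - e_j
evolves linearly under A and stays zero. So e is periodic, hence bounded, whatever the moduli of the
eigenvalues (`shadow_of_iterate_eq`).

The geometric input is that ι(Fq) - ι(Fp) = A(ι(q) - ι(p)) for p, q in one fibre, and that ι(q) -
ι(p) is then integral (`abelJacobi_lift_sub`, `exists_int_abelJacobi_sub`). A path from p to q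
projects to a loop whose class has coordinates ι(q) - ι(p), and its image under F projects to the
f-image of that loop. As f is only continuous, this needs integrals of closed forms along continuous
paths. These are built from local primitives and shown to depend only on homology. -/

/-- A closed one-form on a topological space, given by primitives on the members of an open cover
that differ by locally constant functions. -/
structure LocalPrimitives (X : Type*) [TopologicalSpace X] where
  nhd : X → Set X
  isOpen_nhd : ∀ i, IsOpen (nhd i)
  mem_nhd : ∀ i, i ∈ nhd i
  prim : X → X → ℝ
  eventually_sub_eq : ∀ i j x, x ∈ nhd i → x ∈ nhd j →
    ∀ᶠ y in 𝓝 x, prim i y - prim j y = prim i x - prim j x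

/-- The real numbers with the discrete topology. -/
def DiscreteReal : Type := ℝ

/-- The identity map onto the discrete reals. -/
def DiscreteReal.of : ℝ → DiscreteReal := id

/-- The identity map from the discrete reals. -/
def DiscreteReal.toReal : DiscreteReal → ℝ := id

instance : TopologicalSpace DiscreteReal := ⊥
instance : DiscreteTopology DiscreteReal := ⟨rfl⟩

/-! ### Integrals of closed forms along continuous paths -/

namespace LocalPrimitives

variable {X : Type*} [TopologicalSpace X] (P : LocalPrimitives X)
  {T : Type*} [TopologicalSpace T] {T' : Type*} [TopologicalSpace T']

/-- `h` is a primitive of the pull-back of the one-form along `σ`. -/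
def IsPrimitiveAlong (σ : T → X) (h : T → ℝ) : Prop :=
  ∀ t i, σ t ∈ P.nhd i → ∀ᶠ s in 𝓝 t, h s - P.prim i (σ s) = h t - P.prim i (σ t)

variable {P}

theorem IsPrimitiveAlong.comp {σ : T → X} {h : T → ℝ} (hh : P.IsPrimitiveAlong σ h) {φ : T' → T}
    (hφ : Continuous φ) : P.IsPrimitiveAlong (σ ∘ φ) (h ∘ φ) := fun t i hi =>
  hφ.continuousAt.eventually (hh (φ t) i hi)

theorem IsPrimitiveAlong.sub_eq_sub [PreconnectedSpace T] {σ : T → X} {h h' : T → ℝ}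
    (hh : P.IsPrimitiveAlong σ h) (hh' : P.IsPrimitiveAlong σ h') (s t : T) :
    h s - h t = h' s - h' t := by
  have hc : IsLocallyConstant fun t => h t - h' t := by
    rw [IsLocallyConstant.iff_eventually_eq]
    intro t
    filter_upwards [hh t _ (P.mem_nhd _), hh' t _ (P.mem_nhd _)] with s h₁ h₂
    linarith
  have := hc.apply_eq_of_preconnectedSpace s t
  linarith

theorem isPrimitiveAlong_const (x : X) (c : ℝ) :
    P.IsPrimitiveAlong (fun _ : T => x) fun _ => c := fun _ _ _ => .of_forall fun _ => rfl

variable (P)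

/-- The covering space of germs of primitives. -/
def bundleCore : FiberBundleCore X X DiscreteReal where
  baseSet := P.nhd
  isOpen_baseSet := P.isOpen_nhd
  indexAt := id
  mem_baseSet_at := P.mem_nhd
  coordChange i j x v := .of (v.toReal + (P.prim i x - P.prim j x))
  coordChange_self i x _ v := by
    rw [sub_self, add_zero]
    rfl
  -- The fibre is discrete and differences of primitives are locally constant, so the transition map
  -- is locally constant.
  continuousOn_coordChange i j := by
    rintro ⟨x, v⟩ ⟨hx, -⟩
    refine ContinuousAt.continuousWithinAt ?_
    have hv : ∀ᶠ p : X × DiscreteReal in 𝓝 (x, v), p.2 = v :=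
      continuous_snd.continuousAt.eventually_mem (s := {v}) (isOpen_discrete _ |>.mem_nhds rfl)
    have hx' : ∀ᶠ p : X × DiscreteReal in 𝓝 (x, v),
        P.prim i p.1 - P.prim j p.1 = P.prim i x - P.prim j x :=
      (continuous_fst.tendsto (x, v)).eventually (P.eventually_sub_eq i j x hx.1 hx.2)
    refine continuousAt_const.congr 
      (f := fun _ => DiscreteReal.of (v.toReal + (P.prim i x - P.prim j x))) ?_
    filter_upwards [hv, hx'] with p h₁ h₂
    rw [h₁, h₂]
  coordChange_comp i j k x _ v := by
    change v.toReal + (P.prim i x - P.prim j x) + (P.prim j x - P.prim k x) =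
      v.toReal + (P.prim i x - P.prim k x)
    ring

/-- A primitive along `σ` is a lift of `σ` to the covering of germs, and such a lift exists because
`T` is simply connected and locally path connected. -/
theorem exists_isPrimitiveAlong [SimplyConnectedSpace T] [LocallyPathConnectedSpace T]
    (σ : C(T, X)) : ∃ h : T → ℝ, P.IsPrimitiveAlong σ h := by
  let Z := P.bundleCore
  have hcov : IsCoveringMap (Bundle.TotalSpace.proj : Bundle.TotalSpace DiscreteReal Z.Fiber → X) :=
    FiberBundle.isCoveringMap
  obtain ⟨t₀⟩ : Nonempty T := inferInstance
  obtain ⟨G, ⟨-, hG⟩, -⟩ := hcov.existsUnique_continuousMap_lifts σ t₀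
    ⟨σ t₀, DiscreteReal.of 0⟩ rfl
  have hproj : ∀ t, (G t).1 = σ t := fun t => congrFun hG t
  -- A point `(x, v)` of the bundle stands for the germ at `x` of `P.prim x + v`; this is the value
  -- of that germ at its base point.
  refine ⟨fun t => DiscreteReal.toReal (G t).2 + P.prim (σ t) (σ t), fun t i hi => ?_⟩
  have hmem : G t ∈ (Z.localTriv i).source := by
    rw [Z.mem_localTriv_source, hproj]
    exact hi
  have hc : ContinuousAt (fun s => ((Z.localTriv i) (G s)).2) t :=
    continuous_snd.continuousAt.comp
      (((Z.localTriv i).continuousAt hmem).comp G.continuous.continuousAt)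
  have := hc.eventually_mem (isOpen_discrete {((Z.localTriv i) (G t)).2} |>.mem_nhds rfl)
  filter_upwards [this] with s hs
  have hs' : DiscreteReal.toReal (G s).2 + (P.prim (G s).1 (G s).1 - P.prim i (G s).1) =
    DiscreteReal.toReal (G t).2 + (P.prim (G t).1 (G t).1 - P.prim i (G t).1) := hs
  rw [hproj, hproj] at hs'
  linarith

instance : SimplyConnectedSpace unitInterval :=
  have := (convex_Icc (0 : ℝ) 1).contractibleSpace ⟨0, by simp⟩
  inferInstance

instance : LocallyPathConnectedSpace unitInterval := (convex_Icc (0 : ℝ) 1).locallyPathConnectedSpace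

instance : SimplyConnectedSpace (unitInterval × unitInterval) :=
  have := (convex_Icc (0 : ℝ) 1).contractibleSpace ⟨0, by simp⟩
  inferInstance

/-- The integral of the one-form along a continuous path. -/
noncomputable def integral (c : C(unitInterval, X)) : ℝ :=
  (P.exists_isPrimitiveAlong c).choose 1 - (P.exists_isPrimitiveAlong c).choose 0

variable {P}

theorem IsPrimitiveAlong.integral_eq {c : C(unitInterval, X)} {h : unitInterval → ℝ}
    (hh : P.IsPrimitiveAlong c h) : P.integral c = h 1 - h 0 :=
  (P.exists_isPrimitiveAlong c).choose_spec.sub_eq_sub hh 1 0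

/-- One primitive on a parameter space computes the integrals over all paths in it. Taking an
interval, a square or a triangle gives additivity, homotopy invariance and Stokes. -/
theorem IsPrimitiveAlong.integral_comp {σ : C(T, X)} {h : T → ℝ} (hh : P.IsPrimitiveAlong σ h)
    (c : C(unitInterval, T)) : P.integral (σ.comp c) = h (c 1) - h (c 0) :=
  (hh.comp c.continuous).integral_eq (c := σ.comp c)

variable (P)

theorem integral_symm {x y : X} (γ : Path x y) :
    P.integral γ.symm.toContinuousMap = -P.integral γ.toContinuousMap := by
  obtain ⟨h, hh⟩ := P.exists_isPrimitiveAlong γ.toContinuousMap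
  rw [hh.integral_eq]
  have := hh.integral_comp ⟨unitInterval.symm, unitInterval.continuous_symm⟩
  simp only [ContinuousMap.coe_mk, unitInterval.symm_one, unitInterval.symm_zero] at this
  rw [neg_sub, ← this]
  rfl

theorem integral_trans {x y z : X} (γ : Path x y) (γ' : Path y z) :
    P.integral (γ.trans γ').toContinuousMap =
      P.integral γ.toContinuousMap + P.integral γ'.toContinuousMap := by
  obtain ⟨h, hh⟩ := P.exists_isPrimitiveAlong (γ.trans γ').toContinuousMap
  -- Affine reparametrization of the part of the concatenation between times `a` and `b`.
  have key : ∀ (a b : unitInterval) (δ : C(unitInterval, X)), (∀ t : unitInterval, ∀ s : unitInterval,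
      (s : ℝ) = (1 - t) * a + t * b → (γ.trans γ') s = δ t) → P.integral δ = h b - h a := by
    intro a b δ hδ
    have hmem : ∀ t : unitInterval, (1 - (t : ℝ)) * a + t * b ∈ unitInterval := fun t =>
      convex_Icc (0 : ℝ) 1 a.2 b.2 (by linarith [t.2.2]) t.2.1 (by ring)
    let φ : C(unitInterval, unitInterval) := ⟨fun t => ⟨_, hmem t⟩, by fun_prop⟩
    have := hh.integral_comp φ
    have hc : (γ.trans γ').toContinuousMap.comp φ = δ := ContinuousMap.ext fun t => hδ t _ rfl
    rw [hc] at this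
    rw [this]
    congr 2 <;> ext <;> simp [φ]
  have hhalf : (1 / 2 : ℝ) ∈ unitInterval := by constructor <;> norm_num
  rw [key 0 ⟨1 / 2, hhalf⟩ γ.toContinuousMap, key ⟨1 / 2, hhalf⟩ 1 γ'.toContinuousMap,
    hh.integral_eq]
  · ring
  · intro t s hs
    have hs' : (s : ℝ) = (1 + t) / 2 := by rw [hs]; simp; ring
    rw [Path.trans_apply]
    split_ifs with h'
    · have h0 : t = 0 := Subtype.ext (le_antisymm (by rw [hs'] at h'; simp; linarith) t.2.1)
      subst h0
      simp [hs']
    · exact congrArg γ' (Subtype.ext (by simp [hs']; ring))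
  · intro t s hs
    have hs' : (s : ℝ) = t / 2 := by rw [hs]; simp; ring
    rw [Path.trans_apply, dif_pos (by rw [hs']; linarith [t.2.2])]
    exact congrArg γ (Subtype.ext (by simp [hs']; ring))

/-- On the square of the homotopy, the two sides that map to the endpoints are constant and
contribute nothing. -/
theorem integral_eq_of_homotopic {x y : X} {γ γ' : Path x y} (hγ : γ.Homotopic γ') :
    P.integral γ.toContinuousMap = P.integral γ'.toContinuousMap := by
  obtain ⟨G⟩ := hγ
  obtain ⟨h, hh⟩ := P.exists_isPrimitiveAlong (T := unitInterval × unitInterval) G.toContinuousMap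
  have hside : ∀ s : unitInterval, P.integral ((G.toContinuousMap).comp
      ⟨fun t => (s, t), by fun_prop⟩) = h (s, 1) - h (s, 0) := fun s => hh.integral_comp _
  have h0 : h (1, 0) - h (0, 0) = 0 := by
    rw [← sub_self (0 : ℝ)]
    refine IsPrimitiveAlong.sub_eq_sub (P := P) (σ := fun _ : unitInterval => x)
      (h := fun s => h (s, 0)) ?_ (isPrimitiveAlong_const x 0) 1 0
    have := hh.comp (φ := fun s : unitInterval => (s, (0 : unitInterval))) (by fun_prop)
    convert this using 1
    · ext s
      simp
    · rfl
  have h1 : h (1, 1) - h (0, 1) = 0 := by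
    rw [← sub_self (0 : ℝ)]
    refine IsPrimitiveAlong.sub_eq_sub (P := P) (σ := fun _ : unitInterval => y)
      (h := fun s => h (s, 1)) ?_ (isPrimitiveAlong_const y 0) 1 0
    have := hh.comp (φ := fun s : unitInterval => (s, (1 : unitInterval))) (by fun_prop)
    convert this using 1
    · ext s
      simp
    · rfl
  have e0 : γ.toContinuousMap = (G.toContinuousMap).comp
      ⟨fun t => ((0 : unitInterval), t), by fun_prop⟩ := by
    ext t
    simp
  have e1 : γ'.toContinuousMap = (G.toContinuousMap).comp
      ⟨fun t => ((1 : unitInterval), t), by fun_prop⟩ := by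
    ext t
    simp
  have hi := congrArg P.integral e0
  have hi' := congrArg P.integral e1
  rw [hside] at hi hi'
  linarith

/-- The period homomorphism on the fundamental group. -/
noncomputable def periodHom (x : X) : FundamentalGroup X x →* Multiplicative ℝ where
  toFun a := .ofAdd (Quotient.lift (fun γ : Path x x => P.integral γ.toContinuousMap)
    (fun _ _ => P.integral_eq_of_homotopic) a)
  map_one' := by
    have := P.integral_trans (Path.refl x) (Path.refl x)
    rw [Path.refl_trans_refl, left_eq_add] at this
    exact this
  map_mul' a b := by
    induction a using Quotient.inductionOn with | _ γ
    induction b using Quotient.inductionOn with | _ γ'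
    -- Multiplication in `FundamentalGroup` concatenates in the reverse order.
    exact (P.integral_trans γ' γ).trans (add_comm _ _)

/-- The period homomorphism has abelian target, so it kills commutators. -/
theorem integral_comp_eq_zero {Y : Type*} [TopologicalSpace Y] (π : C(Y, X)) {p : Y}
    (hπ : (FundamentalGroup.map π p).range ≤ commutator (FundamentalGroup X (π p)))
    (γ : Path p p) : P.integral (π.comp γ.toContinuousMap) = 0 := by
  have h₁ : FundamentalGroup.map π p ⟦γ⟧ ∈ (P.periodHom (π p)).ker :=
    Abelianization.commutator_subset_ker _ (hπ ⟨_, rfl⟩)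
  exact h₁

theorem integral_comp_eq_integral_comp {Y : Type*} [TopologicalSpace Y] (π : C(Y, X)) {p q : Y}
    (hπ : (FundamentalGroup.map π p).range ≤ commutator (FundamentalGroup X (π p)))
    (γ γ' : Path p q) :
    P.integral (π.comp γ.toContinuousMap) = P.integral (π.comp γ'.toContinuousMap) := by
  have h := P.integral_comp_eq_zero π hπ (γ.trans γ'.symm)
  have h' := P.integral_trans (γ.map π.continuous) (γ'.map π.continuous).symm
  rw [integral_symm, Path.map_symm, ← Path.map_trans] at h'
  have h'' : 0 = P.integral (π.comp γ.toContinuousMap) + -P.integral (π.comp γ'.toContinuousMap) :=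
    h.symm.trans h'
  linarith

end LocalPrimitives

/-! ### Integration as a singular cocycle -/

section Homology
open Limits

variable {X : Type u} [TopologicalSpace X]

/-- A singular `1`-simplex, viewed as a map on the unit interval. -/
noncomputable def edgeMap (σ : (TopCat.toSSet.obj (TopCat.of X)).obj (.op (SimplexCategory.mk 1))) :
    C(unitInterval, X) :=
  (TopCat.toSSetObjEquiv (TopCat.of X) (.op (SimplexCategory.mk 1)) σ).comp
    ⟨stdSimplexHomeomorphUnitInterval.symm, stdSimplexHomeomorphUnitInterval.symm.continuous⟩

theorem edgeMap_pathSimplex {x y : X} (γ : Path x y) :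
    edgeMap (pathSimplex γ) = γ.toContinuousMap := by
  ext t
  simp [edgeMap, pathSimplex]

theorem stdSimplexHomeomorphUnitInterval_symm_zero :
    stdSimplexHomeomorphUnitInterval.symm 0 = stdSimplex.vertex (S := ℝ) (0 : Fin 2) :=
  stdSimplexHomeomorphUnitInterval.symm_apply_eq.2 rfl

theorem stdSimplexHomeomorphUnitInterval_symm_one :
    stdSimplexHomeomorphUnitInterval.symm 1 = stdSimplex.vertex (S := ℝ) (1 : Fin 2) :=
  stdSimplexHomeomorphUnitInterval.symm_apply_eq.2 rfl

namespace LocalPrimitives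

variable (P : LocalPrimitives X)

instance : SimplyConnectedSpace (stdSimplex ℝ (Fin 3)) :=
  have := (convex_stdSimplex ℝ (Fin 3)).contractibleSpace ⟨_, single_mem_stdSimplex ℝ 0⟩
  inferInstance

instance : LocallyPathConnectedSpace (stdSimplex ℝ (Fin 3)) :=
  (convex_stdSimplex ℝ (Fin 3)).locallyPathConnectedSpace

/-- The real line as a coefficient module. -/
abbrev realModule : ModuleCat.{u} ℤ := ModuleCat.of ℤ (ULift.{u} ℝ)

/-- Multiplication by a real number. -/
def scale (r : ℝ) : coeffs.{u} ⟶ realModule.{u} :=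
  ModuleCat.ofHom
    { toFun z := ULift.up (z.down * r)
      map_add' z w := by ext; simp [add_mul]
      map_smul' n z := by ext; simp [mul_assoc] }

/-- The singular cochain given by integration. -/
noncomputable def cochain :
    ((TopCat.toSSet.obj (TopCat.of X)).chainComplex coeffs.{u}).X 1 ⟶ realModule.{u} :=
  Cofan.IsColimit.desc (SSet.isColimitChainComplexXCofan (TopCat.toSSet.obj (TopCat.of X))
    coeffs.{u} 1) fun σ => scale (P.integral (edgeMap σ))

theorem ι_cochain (σ : (TopCat.toSSet.obj (TopCat.of X)).obj (.op (SimplexCategory.mk 1))) :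
    SSet.ιChainComplex (R := coeffs.{u}) (TopCat.toSSet.obj (TopCat.of X)) σ ≫ P.cochain =
      scale (P.integral (edgeMap σ)) :=
  Cofan.IsColimit.fac (SSet.isColimitChainComplexXCofan (TopCat.toSSet.obj (TopCat.of X))
    coeffs.{u} 1) _ σ

/-- Stokes on a triangle: the integral over each face is a difference of vertex values of one
primitive, and the alternating sum cancels. -/
theorem d_cochain :
    ((TopCat.toSSet.obj (TopCat.of X)).chainComplex coeffs.{u}).d 2 1 ≫ P.cochain = 0 := by
  refine SSet.chainComplex_hom_ext fun σ => ?_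
  let τ : C(stdSimplex ℝ (Fin 3), X) :=
    TopCat.toSSetObjEquiv (TopCat.of X) (.op (SimplexCategory.mk 2)) σ
  obtain ⟨h, hh⟩ := P.exists_isPrimitiveAlong τ
  have hface : ∀ i : Fin 3, P.integral (edgeMap ((TopCat.toSSet.obj (TopCat.of X)).δ i σ)) =
      h (stdSimplex.vertex (i.succAbove 1)) - h (stdSimplex.vertex (i.succAbove 0)) := by
    intro i
    have := hh.integral_comp (⟨stdSimplex.map i.succAbove ∘ stdSimplexHomeomorphUnitInterval.symm,
      (stdSimplex.continuous_map _).comp stdSimplexHomeomorphUnitInterval.symm.continuous⟩ :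
        C(unitInterval, stdSimplex ℝ (Fin 3)))
    simp only [ContinuousMap.coe_mk, Function.comp_apply, stdSimplexHomeomorphUnitInterval_symm_one,
      stdSimplexHomeomorphUnitInterval_symm_zero, stdSimplex.map_vertex] at this
    exact this
  rw [SSet.ιChainComplex_d_assoc, Preadditive.sum_comp, comp_zero, Fin.sum_univ_three]
  simp only [Preadditive.zsmul_comp, ι_cochain, hface]
  ext
  simp [scale, -SSet.ιChainComplex_d]
  rw [show Fin.succAbove (2 : Fin 3) (1 : Fin 2) = 1 from rfl]
  ring

/-- The homomorphism on the first homology group given by integration. -/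
noncomputable def period : H1 X →ₗ[ℤ] ℝ :=
  ULift.moduleEquiv.toLinearMap ∘ₗ
    (((TopCat.toSSet.obj (TopCat.of X)).chainComplex coeffs.{u}).homologyι 1 ≫
      ((TopCat.toSSet.obj (TopCat.of X)).chainComplex coeffs.{u}).descOpcycles P.cochain 2
        (ChainComplex.prev ℕ 1) P.d_cochain).hom

theorem period_eq {x : X} {γ : Path x x} {a : H1 X} (h : Represents γ a) :
    P.period a = P.integral γ.toContinuousMap := by
  obtain ⟨z, hz, rfl⟩ := h
  have h₁ : ((TopCat.toSSet.obj (TopCat.of X)).chainComplex coeffs.{u}).homologyπ 1 ≫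
      ((TopCat.toSSet.obj (TopCat.of X)).chainComplex coeffs.{u}).homologyι 1 ≫
      ((TopCat.toSSet.obj (TopCat.of X)).chainComplex coeffs.{u}).descOpcycles P.cochain 2
        (ChainComplex.prev ℕ 1) P.d_cochain =
      ((TopCat.toSSet.obj (TopCat.of X)).chainComplex coeffs.{u}).iCycles 1 ≫ P.cochain := by
    simp
  have h₂ := ConcreteCategory.congr_hom h₁ z
  have h₃ := ConcreteCategory.congr_hom (P.ι_cochain (pathSimplex γ)) (ULift.up 1)
  have h₄ := congrArg P.cochain.hom hz
  refine (congrArg ULift.down (h₂.trans (h₄.trans h₃))).trans ?_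
  change ((1 : ℤ) : ℝ) * P.integral (edgeMap (pathSimplex γ)) = _
  rw [edgeMap_pathSimplex, Int.cast_one, one_mul]

end LocalPrimitives

theorem toSSetObjEquiv_pathSimplex_vertex {x y : X} (γ : Path x y) (i : Fin 2) :
    TopCat.toSSetObjEquiv (TopCat.of X) (.op (SimplexCategory.mk 1)) (pathSimplex γ)
      (stdSimplex.vertex (S := ℝ) i) = if i = 0 then x else y := by
  have h : TopCat.toSSetObjEquiv (TopCat.of X) (.op (SimplexCategory.mk 1)) (pathSimplex γ)
      (stdSimplex.vertex (S := ℝ) i) =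
        γ (stdSimplexHomeomorphUnitInterval (stdSimplex.vertex (S := ℝ) i)) := by
    simp only [pathSimplex, Equiv.apply_symm_apply]
    rfl
  rw [h]
  fin_cases i
  · exact γ.source
  · exact γ.target

/-- The boundary is the difference of the endpoints, which coincide for a loop. -/
theorem ιChainComplex_pathSimplex_d {x : X} (γ : Path x x) :
    SSet.ιChainComplex (R := coeffs.{u}) (TopCat.toSSet.obj (TopCat.of X)) (pathSimplex γ) ≫
      ((TopCat.toSSet.obj (TopCat.of X)).chainComplex coeffs.{u}).d 1 0 = 0 := by
  have h : (TopCat.toSSet.obj (TopCat.of X)).δ 0 (pathSimplex γ) =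
      (TopCat.toSSet.obj (TopCat.of X)).δ 1 (pathSimplex γ) := by
    refine (TopCat.toSSetObjEquiv (TopCat.of X) (.op (SimplexCategory.mk 0))).injective ?_
    ext z
    obtain rfl : z = stdSimplex.vertex (S := ℝ) (0 : Fin 1) := Subsingleton.elim _ _
    rw [TopCat.toSSetObjEquiv_δ_apply, TopCat.toSSetObjEquiv_δ_apply, stdSimplex.map_vertex,
      stdSimplex.map_vertex, toSSetObjEquiv_pathSimplex_vertex, toSSetObjEquiv_pathSimplex_vertex,
      ite_self, ite_self]
  rw [SSet.ιChainComplex_d, Fin.sum_univ_two, h]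
  simp

theorem exists_represents {x : X} (γ : Path x x) : ∃ a : H1 X, Represents γ a := by
  let K := (TopCat.toSSet.obj (TopCat.of X)).chainComplex coeffs.{u}
  let l := K.liftCycles (SSet.ιChainComplex (R := coeffs.{u}) (TopCat.toSSet.obj (TopCat.of X))
    (pathSimplex γ)) 0 (ChainComplex.next_nat_succ 0) (ιChainComplex_pathSimplex_d γ)
  refine ⟨K.homologyπ 1 (l (ULift.up 1)), l (ULift.up 1), ?_, rfl⟩
  exact ConcreteCategory.congr_hom (K.liftCycles_i (SSet.ιChainComplex (R := coeffs.{u})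
    (TopCat.toSSet.obj (TopCat.of X)) (pathSimplex γ)) 0 (ChainComplex.next_nat_succ 0)
      (ιChainComplex_pathSimplex_d γ)) (ULift.up 1)

theorem Represents.map {x : X} {γ : Path x x} {a : H1 X} (h : Represents γ a) (f : C(X, X)) :
    Represents (γ.map f.continuous) (H1map f a) := by
  obtain ⟨z, hz, rfl⟩ := h
  let φ := SSet.chainComplexMap (TopCat.toSSet.map (TopCat.ofHom f)) coeffs.{u}
  refine ⟨HomologicalComplex.cyclesMap φ 1 z, ?_, ?_⟩
  · refine (ConcreteCategory.congr_hom (HomologicalComplex.cyclesMap_i φ 1) z).trans ?_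
    refine (congrArg (φ.f 1).hom hz).trans ?_
    exact ConcreteCategory.congr_hom (SSet.ι_chainComplexMap_f _ _
      (TopCat.toSSet.map (TopCat.ofHom f)) coeffs.{u} (pathSimplex γ)) (ULift.up 1)
  · exact (ConcreteCategory.congr_hom (HomologicalComplex.homologyπ_naturality φ 1) z).symm

end Homology

/-! ### Local primitives of smooth closed forms -/

section Forms

variable {E : Type*} [NormedAddCommGroup E] [NormedSpace ℝ E] {H : Type*} [TopologicalSpace H]
  {I : ModelWithCorners ℝ E H} {M : Type*} [TopologicalSpace M] [ChartedSpace H M]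

/-- A function whose differential vanishes near a point is constant near that point. -/
theorem eventually_eq_of_hasMFDerivAt_zero [IsManifold I ∞ M] {d : M → ℝ} {x : M}
    (hd : ∀ᶠ p in 𝓝 x, HasMFDerivAt I 𝓘(ℝ, ℝ) d p 0) : ∀ᶠ p in 𝓝 x, d p = d x := by
  have h1 : ∀ᶠ z in 𝓝[range I] (extChartAt I x x), z ∈ (extChartAt I x).target ∧
      HasMFDerivAt I 𝓘(ℝ, ℝ) d ((extChartAt I x).symm z) 0 := by
    refine Filter.Eventually.and (extChartAt_target_mem_nhdsWithin x) ?_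
    have := (continuousAt_extChartAt_symm (I := I) x)
    rw [ContinuousAt, extChartAt_to_inv] at this
    exact nhdsWithin_le_nhds (this.eventually hd)
  obtain ⟨ε, hε, hball⟩ := Metric.mem_nhdsWithin_iff.1 h1
  -- The range of the model is convex, so the mean value inequality also applies at boundary points.
  have hconv : Convex ℝ (Metric.ball (extChartAt I x x) ε ∩ range I) :=
    (convex_ball _ _).inter I.convex_range
  have hder : ∀ z ∈ Metric.ball (extChartAt I x x) ε ∩ range I,
      HasFDerivWithinAt (d ∘ (extChartAt I x).symm) (0 : E →L[ℝ] ℝ)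
        (Metric.ball (extChartAt I x x) ε ∩ range I) z := by
    intro z hz
    obtain ⟨hz₁, hz₂⟩ := hball hz
    have h2 := hz₂.comp_hasMFDerivWithinAt z
      (mdifferentiableWithinAt_extChartAt_symm (I := I) hz₁).hasMFDerivWithinAt
    have h3 := (hasMFDerivWithinAt_iff_hasFDerivWithinAt.1 h2).mono
      (t := range I) (s := Metric.ball (extChartAt I x x) ε ∩ range I) inter_subset_right
    exact h3.congr_fderiv (ContinuousLinearMap.zero_comp _)
  have hconst : ∀ z ∈ Metric.ball (extChartAt I x x) ε ∩ range I,
      d ((extChartAt I x).symm z) = d x := by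
    intro z hz
    have := hconv.norm_image_sub_le_of_norm_hasFDerivWithin_le hder (C := 0) (by simp)
      ⟨Metric.mem_ball_self hε, mem_range_self _⟩ hz
    simpa [sub_eq_zero] using this
  filter_upwards [extChartAt_source_mem_nhds (I := I) x,
    (continuousAt_extChartAt (I := I) x).preimage_mem_nhds (Metric.ball_mem_nhds _ hε)] with p h₁ h₂
  have := hconst _ ⟨h₂, extChartAt_target_subset_range x ((extChartAt I x).map_source h₁)⟩
  rwa [(extChartAt I x).left_inv h₁] at this

/-- Poincaré lemma on the convex set that a small ball cuts out of the model's range, pulled back by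
the chart. -/
theorem IsClosedOneForm.exists_primitive [IsManifold I ∞ M]
    {η : ∀ x : M, TangentSpace I x →L[ℝ] ℝ} (hη : IsClosedOneForm I η) (x : M) :
    ∃ (U : Set M) (g : M → ℝ), IsOpen U ∧ x ∈ U ∧ ContMDiffOn I 𝓘(ℝ, ℝ) 1 g U ∧
      ∀ p ∈ U, HasMFDerivAt I 𝓘(ℝ, ℝ) g p (η p) := by
  obtain ⟨ε, hε, hball⟩ := Metric.mem_nhdsWithin_iff.1 (extChartAt_target_mem_nhdsWithin (I := I) x)
  set S := Metric.ball (extChartAt I x x) ε ∩ range I with hS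
  have hconv : Convex ℝ S := (convex_ball _ _).inter I.convex_range
  have hSr : ∀ z ∈ S, S ∈ 𝓝[range I] z := fun z hz =>
    Filter.inter_mem (mem_nhdsWithin_of_mem_nhds (Metric.isOpen_ball.mem_nhds hz.1))
      self_mem_nhdsWithin
  have huniq : UniqueDiffOn ℝ S := by
    rw [hS, inter_comm]
    exact I.uniqueDiffOn.inter Metric.isOpen_ball
  have hsmooth : ContDiffOn ℝ ∞ (chartForm I η x) S := (hη x).1.mono hball
  have heq : ∀ z ∈ S, fderivWithin ℝ (chartForm I η x) S z =
      fderivWithin ℝ (chartForm I η x) (extChartAt I x).target z := by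
    intro z hz
    refine fderivWithin_congr_set ?_
    have h₁ := mem_nhdsWithin_iff_eventually.1 (hSr z hz)
    filter_upwards [h₁] with w hw
    exact propext ⟨fun h => hball h, fun h => hw (extChartAt_target_subset_range x h)⟩
  obtain ⟨G, hG⟩ := hconv.exists_forall_hasFDerivWithinAt_of_fderivWithin_symmetric
    (hsmooth.differentiableOn (by simp)) (fun a ha v _ w _ => by
      rw [heq a ha]; exact (hη x).2 a (hball ha) v w)
  have hGs : ContDiffOn ℝ 1 G S := by
    refine contDiffOn_succ_of_fderivWithin (n := 0) (fun z hz => (hG z hz).differentiableWithinAt)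
      (by simp) (contDiffOn_zero.2 ?_)
    exact hsmooth.continuousOn.congr fun z hz => (hG z hz).fderivWithin (huniq z hz)
  refine ⟨(extChartAt I x).source ∩ extChartAt I x ⁻¹' Metric.ball (extChartAt I x x) ε,
    G ∘ extChartAt I x, isOpen_extChartAt_preimage' x Metric.isOpen_ball,
    ⟨mem_extChartAt_source x, Metric.mem_ball_self hε⟩, ?_, ?_⟩
  · refine hGs.contMDiffOn.comp ((contMDiffOn_extChartAt (n := 1)).mono ?_) ?_
    · rw [← extChartAt_source I]
      exact inter_subset_left
    · exact fun p hp => ⟨hp.2, extChartAt_target_subset_range x ((extChartAt I x).map_source hp.1)⟩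
  · intro p hp
    have hpS : extChartAt I x p ∈ S :=
      ⟨hp.2, extChartAt_target_subset_range x ((extChartAt I x).map_source hp.1)⟩
    have h₁ := ((hG _ hpS).mono_of_mem_nhdsWithin (hSr _ hpS)).hasMFDerivWithinAt
    have h₂ : HasMFDerivAt I 𝓘(ℝ, E) (extChartAt I x) p (mfderiv I 𝓘(ℝ, E) (extChartAt I x) p) :=
      (mdifferentiableAt_extChartAt (by simpa using hp.1)).hasMFDerivAt
    have h₃ := h₁.comp p (h₂.hasMFDerivWithinAt (s := (extChartAt I x).source)) fun q hq =>
      extChartAt_target_subset_range x ((extChartAt I x).map_source hq)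
    have h₄ := h₃.hasMFDerivAt ((isOpen_extChartAt_source x).mem_nhds hp.1)
    refine h₄.congr_mfderiv ?_
    have h₅ := mfderivWithin_extChartAt_symm_comp_mfderiv_extChartAt' (I := I) hp.1
    -- The tangent space depends on the base point, so the equality of points is eliminated by
    -- substitution instead of rewriting.
    have h₆ : ∀ q : M, q = p → ∀ v : E, η q v = η p v := by
      rintro q rfl v
      rfl
    refine ContinuousLinearMap.ext fun v => ?_
    exact (h₆ _ ((extChartAt I x).left_inv hp.1) _).trans
      (congrArg (η p) (DFunLike.congr_fun h₅ v))

/-- The local primitives of a closed one-form on a manifold. -/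
noncomputable def IsClosedOneForm.localPrimitives [IsManifold I ∞ M]
    {η : ∀ x : M, TangentSpace I x →L[ℝ] ℝ} (hη : IsClosedOneForm I η) : LocalPrimitives M where
  nhd x := (hη.exists_primitive x).choose
  isOpen_nhd x := (hη.exists_primitive x).choose_spec.choose_spec.1
  mem_nhd x := (hη.exists_primitive x).choose_spec.choose_spec.2.1
  prim x := (hη.exists_primitive x).choose_spec.choose
  eventually_sub_eq i j x hi hj := by
    refine eventually_eq_of_hasMFDerivAt_zero (I := I) ?_
    filter_upwards [(hη.exists_primitive i).choose_spec.choose_spec.1.mem_nhds hi,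
      (hη.exists_primitive j).choose_spec.choose_spec.1.mem_nhds hj] with p h₁ h₂
    have h := ((hη.exists_primitive i).choose_spec.choose_spec.2.2.2 p h₁).sub
      ((hη.exists_primitive j).choose_spec.choose_spec.2.2.2 p h₂)
    exact h.congr_mfderiv (sub_self (η p))

variable [IsManifold I ∞ M] {η : ∀ x : M, TangentSpace I x →L[ℝ] ℝ} (hη : IsClosedOneForm I η)

theorem IsClosedOneForm.contMDiffOn_prim (i : M) :
    ContMDiffOn I 𝓘(ℝ, ℝ) 1 (hη.localPrimitives.prim i) (hη.localPrimitives.nhd i) :=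
  (hη.exists_primitive i).choose_spec.choose_spec.2.2.1

theorem IsClosedOneForm.hasMFDerivAt_prim {i p : M} (hp : p ∈ hη.localPrimitives.nhd i) :
    HasMFDerivAt I 𝓘(ℝ, ℝ) (hη.localPrimitives.prim i) p (η p) :=
  (hη.exists_primitive i).choose_spec.choose_spec.2.2.2 p hp

/-- The primitive along `γ` is C¹ with derivative η(γ'), so this is the fundamental theorem of
calculus. -/
theorem IsClosedOneForm.pathIntegral_eq {x y : M} {γ : Path x y} (hγ : IsSmoothPath I γ) :
    pathIntegral I η γ = hη.localPrimitives.integral γ.toContinuousMap := by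
  obtain ⟨h, hh⟩ := hη.localPrimitives.exists_isPrimitiveAlong γ.toContinuousMap
  rw [hh.integral_eq]
  let k : ℝ → ℝ := IccExtend zero_le_one h
  have hloc : ∀ t ∈ Icc (0 : ℝ) 1, ∀ i, γ.extend t ∈ hη.localPrimitives.nhd i →
      ∃ c, k =ᶠ[𝓝[Icc 0 1] t] fun s => hη.localPrimitives.prim i (γ.extend s) + c := by
    intro t ht i hi
    have hc := (hh.comp (φ := projIcc (0 : ℝ) 1 zero_le_one) continuous_projIcc) t i hi
    refine ⟨h (projIcc 0 1 zero_le_one t) - hη.localPrimitives.prim i (γ.extend t),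
      Filter.Eventually.filter_mono nhdsWithin_le_nhds ?_⟩
    filter_upwards [hc] with s hs
    have hs' : k s - hη.localPrimitives.prim i (γ.extend s) =
      h (projIcc 0 1 zero_le_one t) - hη.localPrimitives.prim i (γ.extend t) := hs
    linarith
  have hder : ∀ t ∈ Icc (0 : ℝ) 1, derivWithin k (Icc 0 1) t =
      η (γ.extend t) (mfderivWithin 𝓘(ℝ, ℝ) I γ.extend (Icc 0 1) t (1 : ℝ)) := by
    intro t ht
    obtain ⟨c, hc⟩ := hloc t ht _ (hη.localPrimitives.mem_nhd (γ.extend t))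
    have h₁ := (hη.hasMFDerivAt_prim (hη.localPrimitives.mem_nhd (γ.extend t))).comp_hasMFDerivWithinAt
      t ((hγ t ht).mdifferentiableWithinAt (by simp)).hasMFDerivWithinAt
    have h₂ : HasFDerivWithinAt (hη.localPrimitives.prim (γ.extend t) ∘ γ.extend)
        ((show E →L[ℝ] ℝ from η (γ.extend t)).comp
          (show ℝ →L[ℝ] E from mfderivWithin 𝓘(ℝ, ℝ) I γ.extend (Icc 0 1) t)) (Icc 0 1) t :=
      hasMFDerivWithinAt_iff_hasFDerivWithinAt.1 h₁
    have h₂ := h₂.hasDerivWithinAt.add_const c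
    have h₃ := h₂.congr_of_eventuallyEq hc (hc.self_of_nhdsWithin ht)
    exact h₃.derivWithin (uniqueDiffOn_Icc zero_lt_one t ht)
  have hsm : ContDiffOn ℝ 1 k (Icc 0 1) := by
    intro t ht
    obtain ⟨c, hc⟩ := hloc t ht _ (hη.localPrimitives.mem_nhd (γ.extend t))
    have h₁ := ((hη.contMDiffOn_prim _).contMDiffAt ((hη.localPrimitives.isOpen_nhd _).mem_nhds
      (hη.localPrimitives.mem_nhd (γ.extend t)))).comp_contMDiffWithinAt t
        ((hγ t ht).of_le (by simp))
    exact (h₁.contDiffWithinAt.add contDiffWithinAt_const).congr_of_eventuallyEq hc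
      (hc.self_of_nhdsWithin ht)
  have hint := intervalIntegral.integral_derivWithin_Icc_of_contDiffOn_Icc hsm zero_le_one
  have hk : k 1 - k 0 = h 1 - h 0 := by
    congr 1
    · exact congrArg h (projIcc_right _)
    · exact congrArg h (projIcc_left _)
  rw [← hk, ← hint, pathIntegral]
  refine intervalIntegral.integral_congr fun t ht => ?_
  rw [uIcc_of_le zero_le_one] at ht
  exact (hder t ht).symm

end Forms

/-! ### Smooth paths in the cover and the Abel-Jacobi map -/

section Cover

variable {E : Type*} [NormedAddCommGroup E] [NormedSpace ℝ E] {H : Type*} [TopologicalSpace H]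
  (I : ModelWithCorners ℝ E H) {M : Type*} [TopologicalSpace M] [ChartedSpace H M]
  {Ma : Type*} [TopologicalSpace Ma]

/-- `p` and `q` are joined by a curve, constant near its ends, whose projection is smooth. -/
def SmoothlyJoined (π : Ma → M) (p q : Ma) : Prop :=
  ∃ c : ℝ → Ma, Continuous c ∧ (∀ t ≤ 0, c t = p) ∧ (∀ t, 1 ≤ t → c t = q) ∧
    ContMDiff 𝓘(ℝ, ℝ) I ∞ (π ∘ c)

variable {I}

theorem SmoothlyJoined.symm {π : Ma → M} {p q : Ma} (h : SmoothlyJoined I π p q) :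
    SmoothlyJoined I π q p := by
  obtain ⟨c, hc, h0, h1, hs⟩ := h
  refine ⟨fun t => c (1 - t), by fun_prop, fun t ht => h1 _ (by linarith),
    fun t ht => h0 _ (by linarith), ?_⟩
  exact hs.comp (contMDiff_iff_contDiff.2 (by fun_prop : ContDiff ℝ ∞ fun t : ℝ => 1 - t))

theorem SmoothlyJoined.trans {π : Ma → M} {p q r : Ma} (h : SmoothlyJoined I π p q)
    (h' : SmoothlyJoined I π q r) : SmoothlyJoined I π p r := by
  obtain ⟨c, hc, h0, h1, hs⟩ := h
  obtain ⟨c', hc', h0', h1', hs'⟩ := h'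
  -- Speed 3 makes both pieces rest at `q` for 1/3 ≤ t ≤ 2/3, so they agree on an open overlap and
  -- glue smoothly.
  let d : ℝ → Ma := fun t => if t ≤ 1 / 2 then c (3 * t) else c' (3 * t - 2)
  have hd : ∀ t < 2 / 3, d t = c (3 * t) := by
    intro t ht
    by_cases h : t ≤ 1 / 2
    · exact if_pos h
    · simp only [d, if_neg h]
      rw [h0' _ (by linarith), h1 _ (by linarith)]
  have hd' : ∀ t, 1 / 3 < t → d t = c' (3 * t - 2) := by
    intro t ht
    by_cases h : t ≤ 1 / 2
    · simp only [d, if_pos h]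
      rw [h0' _ (by linarith), h1 _ (by linarith)]
    · exact if_neg h
  have hcases : ∀ t : ℝ, d =ᶠ[𝓝 t] (fun s => c (3 * s)) ∨ d =ᶠ[𝓝 t] fun s => c' (3 * s - 2) := by
    intro t
    rcases lt_or_ge t (2 / 3) with h | h
    · exact .inl (Filter.mem_of_superset (Iio_mem_nhds h) hd)
    · exact .inr (Filter.mem_of_superset (Ioi_mem_nhds (by linarith : 1 / 3 < t)) hd')
  refine ⟨d, continuous_iff_continuousAt.2 fun t => ?_, fun t ht => ?_, fun t ht => ?_, fun t => ?_⟩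
  · rcases hcases t with h | h
    · exact ContinuousAt.congr (by fun_prop) h.symm
    · exact ContinuousAt.congr (by fun_prop) h.symm
  · rw [hd t (by linarith), h0 _ (by linarith)]
  · rw [hd' t (by linarith), h1' _ (by linarith)]
  · rcases hcases t with h | h
    · refine ContMDiffAt.congr_of_eventuallyEq ?_ (h.fun_comp π)
      exact hs.contMDiffAt.comp t (contMDiff_iff_contDiff.2
        (by fun_prop : ContDiff ℝ ∞ fun t : ℝ => 3 * t)).contMDiffAt
    · refine ContMDiffAt.congr_of_eventuallyEq ?_ (h.fun_comp π)
      exact hs'.contMDiffAt.comp t (contMDiff_iff_contDiff.2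
        (by fun_prop : ContDiff ℝ ∞ fun t : ℝ => 3 * t - 2)).contMDiffAt

/-- Take a segment in a chart, slow it down at its ends by `Real.smoothTransition`, and lift it by
the local inverse of the projection. -/
theorem eventually_smoothlyJoined [IsManifold I ∞ M] {π : Ma → M} (hπ : IsLocalHomeomorph π)
    (p : Ma) : ∀ᶠ q in 𝓝 p, SmoothlyJoined I π p q := by
  obtain ⟨φ, hp, rfl⟩ := hπ p
  set x := φ p with hx
  have h1 : ∀ᶠ z in 𝓝[range I] (extChartAt I x x), z ∈ (extChartAt I x).target ∧
      (extChartAt I x).symm z ∈ φ.target := by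
    refine Filter.Eventually.and (extChartAt_target_mem_nhdsWithin x) ?_
    have := (continuousAt_extChartAt_symm (I := I) x)
    rw [ContinuousAt, extChartAt_to_inv] at this
    exact nhdsWithin_le_nhds (this.eventually (φ.open_target.mem_nhds (φ.map_source hp)))
  obtain ⟨ε, hε, hball⟩ := Metric.mem_nhdsWithin_iff.1 h1
  have hconv : Convex ℝ (Metric.ball (extChartAt I x x) ε ∩ range I) :=
    (convex_ball _ _).inter I.convex_range
  have hcont : ContinuousAt φ p := φ.continuousAt hp
  filter_upwards [φ.open_source.mem_nhds hp,
    hcont.preimage_mem_nhds (extChartAt_source_mem_nhds (I := I) x),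
    hcont.preimage_mem_nhds ((continuousAt_extChartAt (I := I) x).preimage_mem_nhds
      (Metric.ball_mem_nhds _ hε))] with q hq₁ hq₂ hq₃
  let z : ℝ → E := fun t =>
    AffineMap.lineMap (extChartAt I x x) (extChartAt I x (φ q)) (Real.smoothTransition t)
  have hz : ContDiff ℝ ∞ z := by
    have h : ContDiff ℝ ∞ Real.smoothTransition := Real.smoothTransition.contDiff
    simp only [z, AffineMap.lineMap_apply_module']
    fun_prop
  have hzS : ∀ t, z t ∈ Metric.ball (extChartAt I x x) ε ∩ range I := fun t =>
    hconv.lineMap_mem ⟨Metric.mem_ball_self hε, mem_range_self _⟩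
      ⟨hq₃, extChartAt_target_subset_range x ((extChartAt I x).map_source hq₂)⟩
      ⟨Real.smoothTransition.nonneg t, Real.smoothTransition.le_one t⟩
  refine ⟨fun t => φ.symm ((extChartAt I x).symm (z t)), ?_, fun t ht => ?_, fun t ht => ?_, ?_⟩
  · refine φ.continuousOn_symm.comp_continuous ?_ fun t => (hball (hzS t)).2
    exact (continuousOn_extChartAt_symm x).comp_continuous hz.continuous
      fun t => (hball (hzS t)).1
  · simp only [z, Real.smoothTransition.zero_of_nonpos ht, AffineMap.lineMap_apply_zero]
    rw [extChartAt_to_inv, hx, φ.left_inv hp]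
  · simp only [z, Real.smoothTransition.one_of_one_le ht, AffineMap.lineMap_apply_one]
    rw [(extChartAt I x).left_inv hq₂, φ.left_inv hq₁]
  · have heq : φ ∘ (fun t => φ.symm ((extChartAt I x).symm (z t))) =
        fun t => (extChartAt I x).symm (z t) :=
      funext fun t => φ.right_inv (hball (hzS t)).2
    rw [heq]
    exact (contMDiffOn_extChartAt_symm x).comp_contMDiff hz.contMDiff
      fun t => (hball (hzS t)).1

theorem smoothlyJoined [IsManifold I ∞ M] [PreconnectedSpace Ma] {π : Ma → M}
    (hπ : IsLocalHomeomorph π) (p q : Ma) : SmoothlyJoined I π p q :=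
  have : Std.Symm (SmoothlyJoined I π) := ⟨fun _ _ => SmoothlyJoined.symm⟩
  PreconnectedSpace.induction₂ (SmoothlyJoined I π) (eventually_smoothlyJoined hπ)
    ⟨fun _ _ _ => SmoothlyJoined.trans⟩ p q

theorem exists_isSmoothPath_map [IsManifold I ∞ M] [PreconnectedSpace Ma] {π : C(Ma, M)}
    (hπ : IsLocalHomeomorph π) (p q : Ma) :
    ∃ γ : Path p q, IsSmoothPath I (γ.map π.continuous) := by
  obtain ⟨c, hc, h0, h1, hs⟩ := smoothlyJoined (I := I) hπ p q
  refine ⟨⟨⟨fun t => c t, by fun_prop⟩, h0 _ (by simp), h1 _ (by simp)⟩, ?_⟩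
  refine hs.contMDiffOn.congr fun t ht => ?_
  rw [Path.extend_apply _ ht]
  rfl

variable [IsManifold I ∞ M] {b : ℕ} {η : Fin b → ∀ x : M, TangentSpace I x →L[ℝ] ℝ}
  (hη : ∀ i, IsClosedOneForm I (η i)) {π : C(Ma, M)} {p₀ : Ma}

/-- Smooth paths exist, so the `epsilon` in `abelJacobi` picks a genuine integral; path independence
in the cover then allows any continuous path. -/
theorem abelJacobi_eq_integral (hπ : IsUniversalAbelianCover π) {p : Ma} (γ : Path p₀ p) (i : Fin b) :
    abelJacobi I π η p₀ p i = (hη i).localPrimitives.integral (π.comp γ.toContinuousMap) := by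
  have := hπ.pathConnected
  obtain ⟨δ, hδ⟩ := exists_isSmoothPath_map (I := I) hπ.isCoveringMap.isLocalHomeomorph p₀ p
  obtain ⟨δ', hδ', h⟩ := Classical.epsilon_spec (p := fun r : ℝ =>
    ∃ γ : Path p₀ p, IsSmoothPath I (γ.map π.continuous) ∧
      pathIntegral I (η i) (γ.map π.continuous) = r) ⟨_, δ, hδ, rfl⟩
  refine h.symm.trans (((hη i).pathIntegral_eq hδ').trans ?_)
  exact (hη i).localPrimitives.integral_comp_eq_integral_comp π (hπ.range_eq p₀).le δ' γ

theorem abelJacobi_sub_eq_integral (hπ : IsUniversalAbelianCover π) {p q : Ma}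
    (σ : Path p q) (i : Fin b) :
    abelJacobi I π η p₀ q i - abelJacobi I π η p₀ p i =
      (hη i).localPrimitives.integral (π.comp σ.toContinuousMap) := by
  have := hπ.pathConnected
  let γ := PathConnectedSpace.somePath p₀ p
  rw [abelJacobi_eq_integral hη hπ γ, abelJacobi_eq_integral hη hπ (γ.trans σ)]
  have h := (hη i).localPrimitives.integral_trans (γ.map π.continuous) (σ.map π.continuous)
  rw [← Path.map_trans] at h
  exact sub_eq_of_eq_add' h

end Cover

/-! ### Equivariance of the Abel-Jacobi map -/

section Periods

variable {E : Type*} [NormedAddCommGroup E] [NormedSpace ℝ E] {H : Type*} [TopologicalSpace H]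
  {I : ModelWithCorners ℝ E H} {M : Type u} [TopologicalSpace M] [ChartedSpace H M]
  [IsManifold I ∞ M] {b : ℕ} {η : Fin b → ∀ x : M, TangentSpace I x →L[ℝ] ℝ}
  {Γ : Module.Basis (Fin b) ℤ (H1 M)} {Ma : Type*} [TopologicalSpace Ma] {π : C(Ma, M)} {p₀ : Ma}

theorem period_eq_repr (hη : ∀ i, IsClosedOneForm I (η i))
    (hdual : ∀ i j, HasPeriod I (η i) (Γ j) (if i = j then 1 else 0)) (a : H1 M) (i : Fin b) :
    (hη i).localPrimitives.period a = Γ.repr a i := by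
  have hΓ : ∀ j, (hη i).localPrimitives.period (Γ j) = if i = j then 1 else 0 := by
    intro j
    obtain ⟨x, γ, hγ, hr, h⟩ := hdual i j
    rw [(hη i).localPrimitives.period_eq hr, ← (hη i).pathIntegral_eq hγ, h]
  conv_lhs => rw [← Γ.sum_repr a, map_sum]
  simp only [map_smul, hΓ]
  simp

/-- The class `a` is that of the loop below a path from `p` to `q`; applying `F` to the path applies
`f` to the loop. -/
theorem exists_abelJacobi_sub_eq
    (hη : ∀ i, IsClosedOneForm I (η i))
    (hdual : ∀ i j, HasPeriod I (η i) (Γ j) (if i = j then 1 else 0))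
    (hπ : IsUniversalAbelianCover π) {f : C(M, M)} {F : Ma → Ma} (hF : IsLift π f F) {p q : Ma}
    (h : π p = π q) :
    ∃ a : H1 M, (∀ i, abelJacobi I π η p₀ q i - abelJacobi I π η p₀ p i = Γ.repr a i) ∧
      ∀ i, abelJacobi I π η p₀ (F q) i - abelJacobi I π η p₀ (F p) i =
        Γ.repr (H1map f a) i := by
  have := hπ.pathConnected
  let σ := PathConnectedSpace.somePath p q
  let γ : Path (π p) (π p) := (σ.map π.continuous).cast rfl h
  obtain ⟨a, ha⟩ := exists_represents γ
  refine ⟨a, fun i => ?_, fun i => ?_⟩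
  · rw [abelJacobi_sub_eq_integral hη hπ σ, ← period_eq_repr hη hdual,
      (hη i).localPrimitives.period_eq ha]
    rfl
  · rw [abelJacobi_sub_eq_integral hη hπ (σ.map hF.1), ← period_eq_repr hη hdual,
      (hη i).localPrimitives.period_eq (ha.map f)]
    congr 1
    ext t
    exact hF.2 (σ t)

theorem abelJacobi_lift_sub (hη : ∀ i, IsClosedOneForm I (η i))
    (hdual : ∀ i j, HasPeriod I (η i) (Γ j) (if i = j then 1 else 0))
    (hπ : IsUniversalAbelianCover π) {f : C(M, M)} {F : Ma → Ma} (hF : IsLift π f F)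
    {A : Matrix (Fin b) (Fin b) ℤ} (hA : LinearMap.toMatrix Γ Γ (H1map f) = A) {p q : Ma}
    (h : π p = π q) :
    abelJacobi I π η p₀ (F q) - abelJacobi I π η p₀ (F p) =
      linAct A (abelJacobi I π η p₀ q - abelJacobi I π η p₀ p) := by
  obtain ⟨a, h₁, h₂⟩ := exists_abelJacobi_sub_eq (p₀ := p₀) hη hdual hπ hF h
  have h₁' : abelJacobi I π η p₀ q - abelJacobi I π η p₀ p = fun i => (Γ.repr a i : ℝ) :=
    funext h₁
  ext i
  rw [Pi.sub_apply, h₂, h₁', ← hA]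
  have h₃ := congrFun (LinearMap.toMatrix_mulVec_repr Γ Γ (H1map f) a) i
  rw [← h₃]
  simp [linAct, Matrix.mulVec, dotProduct]

theorem exists_int_abelJacobi_sub (hη : ∀ i, IsClosedOneForm I (η i))
    (hdual : ∀ i j, HasPeriod I (η i) (Γ j) (if i = j then 1 else 0))
    (hπ : IsUniversalAbelianCover π) {p q : Ma} (h : π p = π q) :
    ∃ n : Fin b → ℤ, abelJacobi I π η p₀ q - abelJacobi I π η p₀ p = fun i => (n i : ℝ) := by
  obtain ⟨a, h₁, -⟩ := exists_abelJacobi_sub_eq (p₀ := p₀) hη hdual hπ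
    (f := ContinuousMap.id M) (F := id) ⟨continuous_id, fun _ => rfl⟩ h
  exact ⟨fun i => Γ.repr a i, funext h₁⟩

end Periods

/-! ### Bowen-Franks classes and points of the torus -/

section Algebra

variable {b : ℕ}

theorem linAct_iterate (A : Matrix (Fin b) (Fin b) ℤ) (k : ℕ) (v : Fin b → ℝ) :
    (linAct A)^[k] v = ((A.map (Int.cast : ℤ → ℝ)) ^ k).mulVec v := by
  induction k with
  | zero => simp
  | succ k ih => rw [Function.iterate_succ_apply', ih, linAct, Matrix.mulVec_mulVec, pow_succ']

theorem linAct_sub (A : Matrix (Fin b) (Fin b) ℤ) (v w : Fin b → ℝ) :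
    linAct A (v - w) = linAct A v - linAct A w :=
  Matrix.mulVec_sub _ _ _

theorem toralEnd_iterate_torusProj (A : Matrix (Fin b) (Fin b) ℤ) (k : ℕ) (v : Fin b → ℝ) :
    (toralEnd A)^[k] (torusProj v) = torusProj ((linAct A)^[k] v) :=
  ((Function.Semiconj.iterate_right (fun v => (toralEnd_torusProj A v).symm) k) v).symm

theorem torusProj_eq_iff {v w : Fin b → ℝ} :
    torusProj v = torusProj w ↔ ∃ m : Fin b → ℤ, v - w = fun i => (m i : ℝ) := by
  have h : ∀ s t : ℝ, (s : AddCircle (1 : ℝ)) = t ↔ ∃ m : ℤ, s - t = m := by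
    intro s t
    rw [← sub_eq_zero, ← AddCircle.coe_sub, AddCircle.coe_eq_zero_iff]
    simp [eq_comm]
  simp only [funext_iff, torusProj, h, Pi.sub_apply]
  exact Classical.skolem

theorem map_intCast_pow_sub_one {R : Type*} [CommRing R] (A : Matrix (Fin b) (Fin b) ℤ) (k : ℕ) :
    (A.map (Int.cast : ℤ → R)) ^ k - 1 = (Int.castRingHom R).mapMatrix (A ^ k - 1) := by
  rw [map_sub, map_pow, map_one]
  rfl

/-- By spectral mapping, an eigenvalue 1 of A^k would come from an eigenvalue μ of A with μ^k = 1.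
The determinant is an integer, so its nonvanishing passes from ℂ to ℝ. -/
theorem NoRootOfUnityEigenvalue.isUnit_pow_sub_one {A : Matrix (Fin b) (Fin b) ℤ}
    (hA : NoRootOfUnityEigenvalue A) {k : ℕ} (hk : 0 < k) :
    IsUnit ((A.map (Int.cast : ℤ → ℝ)) ^ k - 1) := by
  set C : Matrix (Fin b) (Fin b) ℂ := A.map (Int.cast : ℤ → ℂ) with hC
  have h₁ : IsUnit (C ^ k - 1) := by
    by_contra h
    have h₂ : (1 : ℂ) ∈ spectrum ℂ (C ^ k) := by
      rw [spectrum.mem_iff, map_one, ← IsUnit.neg_iff, neg_sub]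
      exact h
    rw [spectrum.map_pow_of_pos C hk] at h₂
    obtain ⟨μ, hμ, hμk⟩ := h₂
    refine hA μ k hk hμk ?_
    rw [Module.End.hasEigenvalue_iff_mem_spectrum, Matrix.spectrum_toLin']
    exact hμ
  rw [Matrix.isUnit_iff_isUnit_det, isUnit_iff_ne_zero] at h₁ ⊢
  rw [map_intCast_pow_sub_one, ← RingHom.map_det, eq_intCast, Int.cast_ne_zero] at h₁ ⊢
  exact h₁

theorem mk_eq_mk_iff_torusProj_eq {A : Matrix (Fin b) (Fin b) ℤ} {k : ℕ}
    (hB : IsUnit ((A.map (Int.cast : ℤ → ℝ)) ^ k - 1)) {n m : Fin b → ℤ} {v : Fin b → ℝ}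
    (hv : ((A.map (Int.cast : ℤ → ℝ)) ^ k - 1).mulVec v = fun i => (m i : ℝ)) :
    (Submodule.Quotient.mk n : BowenFranks A k) = Submodule.Quotient.mk m ↔
      torusProj (((A.map (Int.cast : ℤ → ℝ)) ^ k - 1)⁻¹.mulVec fun i => (n i : ℝ)) =
        torusProj v := by
  set B : Matrix (Fin b) (Fin b) ℝ := (A.map (Int.cast : ℤ → ℝ)) ^ k - 1 with hB'
  have hdet : IsUnit B.det := (Matrix.isUnit_iff_isUnit_det B).1 hB
  have hcast : ∀ w : Fin b → ℤ,
      (fun i => (((A ^ k - 1).mulVec w i : ℤ) : ℝ)) = B.mulVec fun i => (w i : ℝ) := by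
    intro w
    ext i
    rw [hB', map_intCast_pow_sub_one]
    simp [Matrix.mulVec, dotProduct]
  rw [Submodule.Quotient.eq, LinearMap.mem_range, torusProj_eq_iff]
  -- The same integer vector witnesses both sides: Bw = n - m is equivalent to w = B⁻¹n - v, as Bv =
  -- m.
  refine exists_congr fun w => ?_
  have hinj : ((A ^ k - 1).mulVecLin w = n - m) ↔
      B.mulVec (fun i => (w i : ℝ)) = (fun i => (n i : ℝ)) - fun i => (m i : ℝ) := by
    rw [← hcast, Matrix.mulVecLin_apply]
    simp only [funext_iff, Pi.sub_apply]
    exact forall_congr' fun i => by exact_mod_cast Iff.rfl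
  rw [hinj, ← hv]
  constructor
  · intro h
    have := congrArg B⁻¹.mulVec h
    rw [Matrix.mulVec_sub, Matrix.mulVec_mulVec, Matrix.mulVec_mulVec, Matrix.nonsing_inv_mul _ hdet,
      Matrix.one_mulVec, Matrix.one_mulVec] at this
    exact this.symm
  · intro h
    rw [← h, Matrix.mulVec_sub, Matrix.mulVec_mulVec, Matrix.mul_nonsing_inv _ hdet,
      Matrix.one_mulVec]

end Algebra

/-! ### Periodicity of the shadowing error -/

section Shadowing

variable {b : ℕ} {X Xa : Type*}

theorem shadow_of_iterate_eq {A : Matrix (Fin b) (Fin b) ℤ} {π : Xa → X} {ι : Xa → Fin b → ℝ}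
    {f : X → X} {F : Xa → Xa} (hF : Function.Semiconj π F f)
    (hι : ∀ p q, π p = π q → ι (F q) - ι (F p) = linAct A (ι q - ι p)) {k : ℕ} (hk : 0 < k)
    {p : Xa} (hp : Function.IsPeriodicPt f k (π p)) {v : Fin b → ℝ}
    (hv : (linAct A)^[k] v = v + translation ι F^[k] p) : Shadow A ι F p v := by
  let e : ℕ → Fin b → ℝ := fun j => ι (F^[j] p) - (linAct A)^[j] v
  have hπ : ∀ j, π (F^[j + k] p) = π (F^[j] p) := by
    intro j
    rw [(hF.iterate_right _) p, (hF.iterate_right _) p, Function.iterate_add_apply, hp]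
  have he : Function.Periodic e k := by
    intro j
    induction j with
    | zero =>
      simp only [e, zero_add, hv, translation, Function.iterate_zero, id]
      abel
    | succ j ih =>
      rw [← sub_eq_zero] at ih ⊢
      have h := hι _ _ (hπ j).symm
      have h₁ : e (j + 1 + k) - e (j + 1) = linAct A (e (j + k) - e j) := by
        rw [add_right_comm]
        simp only [e, Function.iterate_succ_apply', linAct_sub] at h ⊢
        rw [sub_sub_sub_comm, h]
        abel
      rw [h₁, ih]
      exact Matrix.mulVec_zero _
  -- The sum over one period bounds each of its nonnegative terms.
  refine ⟨∑ r ∈ Finset.range k, ‖WithLp.toLp 2 (e r)‖, fun n => ?_⟩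
  rw [dist_eq_norm, ← WithLp.toLp_sub]
  change ‖WithLp.toLp 2 (e n)‖ ≤ _
  rw [← he.map_mod_nat n]
  exact Finset.single_le_sum (f := fun r => ‖WithLp.toLp 2 (e r)‖) (fun _ _ => norm_nonneg _)
    (Finset.mem_range.2 (Nat.mod_lt n hk))

end Shadowing

end GlobalShadow

theorem mainTheorem8
    {E : Type*} [NormedAddCommGroup E] [NormedSpace ℝ E] [FiniteDimensional ℝ E]
    {H : Type*} [TopologicalSpace H] (I : ModelWithCorners ℝ E H)
    {M : Type u} [TopologicalSpace M] [ChartedSpace H M] [IsManifold I ∞ M]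
    [CompactSpace M] [ConnectedSpace M] [T2Space M]
    {b : ℕ} (Γ : Module.Basis (Fin b) ℤ (GlobalShadow.H1 M))
    (η : Fin b → ∀ x : M, TangentSpace I x →L[ℝ] ℝ)
    (hη : ∀ i, GlobalShadow.IsClosedOneForm I (η i))
    (hdual : ∀ i j, GlobalShadow.HasPeriod I (η i) (Γ j) (if i = j then 1 else 0))
    {Ma : Type*} [TopologicalSpace Ma] (π : C(Ma, M))
    (hπ : GlobalShadow.IsUniversalAbelianCover π) (p₀ : Ma)
    (f : C(M, M)) (A : Matrix (Fin b) (Fin b) ℤ)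
    (hA : LinearMap.toMatrix Γ Γ (GlobalShadow.H1map f) = A)
    (hroot : GlobalShadow.NoRootOfUnityEigenvalue A)
    (F : Ma → Ma) (hF : GlobalShadow.IsLift π f F)
    (k : ℕ) (hk : 0 < k)
    (x : M) (hx : Function.IsPeriodicPt f k x)
    (y : GlobalShadow.Torus b) (hy : Function.IsPeriodicPt (GlobalShadow.toralEnd A) k y) :
    (GlobalShadow.displacement A k hπ.surjective (GlobalShadow.abelJacobi I π η p₀) F^[k] x =
        GlobalShadow.displacement A k GlobalShadow.torusProj_surjective id
          (GlobalShadow.linAct A)^[k] y ↔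
      GlobalShadow.alpha A k hπ.surjective (GlobalShadow.abelJacobi I π η p₀) F^[k] x = y) ∧
    (GlobalShadow.displacement A k hπ.surjective (GlobalShadow.abelJacobi I π η p₀) F^[k] x =
        GlobalShadow.displacement A k GlobalShadow.torusProj_surjective id
          (GlobalShadow.linAct A)^[k] y →
      GlobalShadow.GloballyShadow A π (GlobalShadow.abelJacobi I π η p₀) f x y) := by

  set ι := GlobalShadow.abelJacobi I π η p₀
  have hB := hroot.isUnit_pow_sub_one hk
  have hdet := (Matrix.isUnit_iff_isUnit_det _).1 hB
  have hsemi : Function.Semiconj π F f := hF.2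
  set p := Function.surjInv hπ.surjective x with hp
  have hpx : π p = x := Function.surjInv_eq hπ.surjective x
  have hpk : π p = π (F^[k] p) := by
    rw [hsemi.iterate_right k p, hpx, hx]
  obtain ⟨n, hn⟩ := GlobalShadow.exists_int_abelJacobi_sub (p₀ := p₀) hη hdual hπ hpk
  replace hn : GlobalShadow.translation ι F^[k] p = fun i => (n i : ℝ) := hn
  set w := Function.surjInv GlobalShadow.torusProj_surjective y with hw
  have hwy : GlobalShadow.torusProj w = y :=
    Function.surjInv_eq GlobalShadow.torusProj_surjective y
  obtain ⟨m, hm⟩ : ∃ m : Fin b → ℤ,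
      (GlobalShadow.linAct A)^[k] w - w = fun i => (m i : ℝ) := by
    rw [← GlobalShadow.torusProj_eq_iff, ← GlobalShadow.toralEnd_iterate_torusProj, hwy, hy]
  have hDx : GlobalShadow.displacement A k hπ.surjective ι F^[k] x =
      Submodule.Quotient.mk n := by
    rw [GlobalShadow.displacement, ← hp, hn]
    simp
  have hDy : GlobalShadow.displacement A k GlobalShadow.torusProj_surjective id
      (GlobalShadow.linAct A)^[k] y = Submodule.Quotient.mk m := by
    rw [GlobalShadow.displacement, ← hw]
    simp only [GlobalShadow.translation, id, hm]
    simp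
  have hα : GlobalShadow.alpha A k hπ.surjective ι F^[k] x = GlobalShadow.torusProj
      (((A.map (Int.cast : ℤ → ℝ)) ^ k - 1)⁻¹.mulVec fun i => (n i : ℝ)) := by
    rw [GlobalShadow.alpha, GlobalShadow.alphaLift, ← hp, hn]
  have hBw : ((A.map (Int.cast : ℤ → ℝ)) ^ k - 1).mulVec w = fun i => (m i : ℝ) := by
    rw [Matrix.sub_mulVec, Matrix.one_mulVec, ← GlobalShadow.linAct_iterate, hm]
  have hiff : GlobalShadow.displacement A k hπ.surjective ι F^[k] x =
      GlobalShadow.displacement A k GlobalShadow.torusProj_surjective id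
        (GlobalShadow.linAct A)^[k] y ↔
      GlobalShadow.alpha A k hπ.surjective ι F^[k] x = y := by
    rw [hDx, hDy, hα, GlobalShadow.mk_eq_mk_iff_torusProj_eq hB hBw, hwy]
  -- The lift of y used here is B⁻¹n rather than `w`: it lies over y by the equivalence, and its
  -- translation under A^k is exactly n.
  refine ⟨hiff, fun h => ⟨F, p, GlobalShadow.alphaLift A k ι F^[k] p, hF, hpx, hiff.1 h, ?_⟩⟩
  refine GlobalShadow.shadow_of_iterate_eq hsemi
    (fun p q hpq => GlobalShadow.abelJacobi_lift_sub hη hdual hπ hF hA hpq) hk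
    (by rwa [hpx]) ?_
  rw [← sub_eq_iff_eq_add', GlobalShadow.linAct_iterate]
  conv_lhs => rw [← Matrix.one_mulVec (GlobalShadow.alphaLift A k ι F^[k] p), Matrix.mulVec_mulVec,
    mul_one, ← Matrix.sub_mulVec]
  rw [GlobalShadow.alphaLift, Matrix.mulVec_mulVec, Matrix.mul_nonsing_inv _ hdet, Matrix.one_mulVec]
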